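/- Let $\lambda=(\lambda_n)_{n\ge 1}$ be a frequency, that is, a strictly increasing sequence of nonnegative real numbers tending to $+\infty$. Let $\psi\in L^1(\mathbb R)$ be a complex-valued function whose Fourier transform $\hat\psi(x)=\int_{\mathbb R}\psi(t)e^{-itx}\,dt$ has compact support. (a) Let $\sum_n a_n e^{-\lambda_n s}$ ($a_n\in\mathbb C$) be a Dirichlet series which converges at some point of $\mathbb C$ and whose sum has a bounded holomorphic extension $f$ to the half-plane $\{\operatorname{Re} s>0\}$. Then for every $s\in\mathbb C$ with $\operatorname{Re}s>0$ the function $t\mapsto f(s+it)\psi(t)$ is integrable on $\mathbb R$ and $$\sum_{n=1}^{+\infty}a_n\hat\psi(\lambda_n)e^{-\lambda_n s}=\int_{\mathbb R}f(s+it)\psi(t)\,dt .$$ (b) Let $G$ be a compact (Hausdorff) abelian group with normalized Haar measure, and let $\beta:(\mathbb R,+)\to G$ be a continuous homomorphism with dense range such that for every $n$ there is a (necessarily unique) character $h_{\lambda_n}\in\hat G$ with $h_{\lambda_n}(\beta(t))=e^{-i\lambda_n t}$ for all $t\in\mathbb R$. Let $f\in L^1(G)$ be such that $\hat f(\gamma)=\int_G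 f\,\overline{\gamma}=0$ for every character $\gamma\in\hat G\setminus\{h_{\lambda_n}:n\ge1\}$ (that is, $f\in H_1^\lambda(G)$), and put $a_n=\hat f(h_{\lambda_n})$. Then for almost every $\omega\in G$ the function $t\mapsto f(\omega\beta(t))\psi(t)$ is integrable on $\mathbb R$ and $$\sum_{n=1}^{+\infty}a_n\hat\psi(\lambda_n)h_{\lambda_n}(\omega)=\int_{\mathbb R}f(\omega\beta(t))\psi(t)\,dt .$$ -/

import Mathlib

open MeasureTheory Filter Topology
open scoped ENNReal

namespace GeneralDirichlet

/-- A frequency: a (strictly) increasing sequence of nonnegative reals tending to infinity. -/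
structure IsFrequency (lam : ℕ → ℝ) : Prop where
  strictMono : StrictMono lam
  nonneg : ∀ n, 0 ≤ lam n
  tendsto_atTop : Tendsto lam atTop atTop

/-- The partial sums of the Dirichlet series with coefficients `a` at the point `s`. -/
noncomputable def partialSum (lam : ℕ → ℝ) (a : ℕ → ℂ) (s : ℂ) (N : ℕ) : ℂ :=
  ∑ n ∈ Finset.range N, a n * Complex.exp (-(lam n : ℂ) * s)

/-- The Dirichlet series with coefficients `a` converges (as a limit of partial sums) at `s`. -/
def ConvergesAt (lam : ℕ → ℝ) (a : ℕ → ℂ) (s : ℂ) : Prop :=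
  ∃ l : ℂ, Tendsto (partialSum lam a s) atTop (𝓝 l)

/-- The Dirichlet series with coefficients `a` is somewhere convergent, and its sum (on the open
half-plane of convergence) has the bounded holomorphic extension `f` to the half-plane
`0 < re s`. The values of `f` outside this half-plane are irrelevant. -/
structure IsBoundedExtension (lam : ℕ → ℝ) (a : ℕ → ℂ) (f : ℂ → ℂ) : Prop where
  somewhere_convergent : ∃ s₀ : ℂ, ConvergesAt lam a s₀
  differentiableOn : DifferentiableOn ℂ f {s : ℂ | 0 < s.re}
  bounded : ∃ C : ℝ, ∀ s : ℂ, 0 < s.re → ‖f s‖ ≤ C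
  extends_sum : ∀ s : ℂ, 0 < s.re → (∃ s₀ : ℂ, s₀.re < s.re ∧ ConvergesAt lam a s₀) →
    ∀ l : ℂ, Tendsto (partialSum lam a s) atTop (𝓝 l) → f s = l

/-- The Fourier transform on the real line, normalised as `x ↦ ∫ ψ(t) exp(-i t x) dt`. -/
noncomputable def fourierLine (ψ : ℝ → ℂ) (x : ℝ) : ℂ :=
  ∫ t : ℝ, ψ t * Complex.exp (-Complex.I * (t : ℂ) * (x : ℂ))

section Group

variable {G : Type*} [CommGroup G] [TopologicalSpace G]

/-- `(G, β)` is a Dirichlet group for the frequency `lam`: `β` is a continuous homomorphism from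
`(ℝ, +)` to `G` with dense range, and each `t ↦ exp(-i t lam n)` factors through `β` and a
character of `G`. -/
structure IsDirichletGroup (lam : ℕ → ℝ) (β : Multiplicative ℝ →ₜ* G) : Prop where
  denseRange : DenseRange β
  exists_char : ∀ n, ∃ h : PontryaginDual G, ∀ t : ℝ,
    ((h (β (Multiplicative.ofAdd t)) : Circle) : ℂ)
      = Complex.exp (-Complex.I * (lam n : ℂ) * (t : ℂ))

/-- The character `h_{lam n}` of `G`. -/
noncomputable def IsDirichletGroup.char {lam : ℕ → ℝ} {β : Multiplicative ℝ →ₜ* G}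
    (hβ : IsDirichletGroup lam β) (n : ℕ) : PontryaginDual G :=
  (hβ.exists_char n).choose

theorem IsDirichletGroup.char_apply {lam : ℕ → ℝ} {β : Multiplicative ℝ →ₜ* G}
    (hβ : IsDirichletGroup lam β) (n : ℕ) (t : ℝ) :
    ((hβ.char n (β (Multiplicative.ofAdd t)) : Circle) : ℂ)
      = Complex.exp (-Complex.I * (lam n : ℂ) * (t : ℂ)) :=
  (hβ.exists_char n).choose_spec t

/-- The character `h_{lam n}` is determined by its values along `β`. -/
theorem IsDirichletGroup.eq_char {lam : ℕ → ℝ} {β : Multiplicative ℝ →ₜ* G}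
    (hβ : IsDirichletGroup lam β) (n : ℕ) (h : PontryaginDual G)
    (hh : ∀ t : ℝ, ((h (β (Multiplicative.ofAdd t)) : Circle) : ℂ)
      = Complex.exp (-Complex.I * (lam n : ℂ) * (t : ℂ))) : h = hβ.char n := by
  have key : (fun x => h x) = fun x => hβ.char n x := by
    refine hβ.denseRange.equalizer (map_continuous h) (map_continuous (hβ.char n)) ?_
    funext t
    apply Subtype.ext
    exact (hh t.toAdd).trans (hβ.char_apply n t.toAdd).symm
  exact DFunLike.ext _ _ (congrFun key)

variable [MeasurableSpace G]

/-- The Fourier coefficient of `f` at the character `γ`. -/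
noncomputable def fourierCoeff (μ : Measure G) (f : G → ℂ) (γ : PontryaginDual G) : ℂ :=
  ∫ ω, f ω * (starRingEnd ℂ) ((γ ω : Circle) : ℂ) ∂μ

/-- `f` is (a representative of) an element of the Hardy space `H_p^lam(G)`: it is in `L^p` and
its Fourier transform is supported in the set of the characters `h_{lam n}`. -/
def MemHardy {lam : ℕ → ℝ} {β : Multiplicative ℝ →ₜ* G} (hβ : IsDirichletGroup lam β)
    (p : ℝ≥0∞) (μ : Measure G) (f : G → ℂ) : Prop :=
  MemLp f p μ ∧ ∀ γ : PontryaginDual G, γ ∉ Set.range hβ.char → fourierCoeff μ f γ = 0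

end Group

end GeneralDirichlet

/-! Since `fourierLine ψ` has compact support and `lam` tends to infinity, both series have only
finitely many nonzero terms, so convergence is free and only the value matters. Half-plane case: far
to the right the series may be integrated term by term if `t ψ(t)` is integrable, because Abel
summation bounds its partial sums by a linear function of `|t|` on a vertical line
(`norm_partialSum_le`). A general `ψ` is first multiplied by `window (ε t)`, which decays like
`1/|t|` and enlarges the support of the transform by at most `ε`; then `ε → 0`. Both sides are
holomorphic on `0 < re s`, and the identity theorem concludes. Group case: the integral along the
flow is an integrable function of `ω` whose coefficient at `γ` is that of `f` times `∫ ψ(t) γ(β(t))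
dt` (`fourierCoeff_flow`). These are the coefficients of the finite sum, so uniqueness of Fourier
coefficients suffices. Uniqueness follows from Stone–Weierstrass once characters separate points,
which is deduced from Gelfand theory applied to the translation operators on `L²`. -/

namespace GeneralDirichlet

set_option linter.unusedSectionVars false
set_option linter.overlappingInstances false

/-! ### Characters of a group from Gelfand theory -/

/-- On a commutative closed star subalgebra of a C⋆-algebra, the characters separate points. -/
theorem exists_character_ne_zero {B : Type*} [CStarAlgebra B] (S : StarSubalgebra ℂ B)
    (hS : IsClosed (S : Set B)) (hcomm : ∀ x ∈ S, ∀ y ∈ S, x * y = y * x) {a : S} (ha : a ≠ 0) :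
    ∃ φ : S →ₐ[ℂ] ℂ, Continuous φ ∧ (∀ x, φ (star x) = star (φ x)) ∧ φ a ≠ 0 := by
  have := hS
  let _ : CommCStarAlgebra S :=
    { (inferInstance : CStarAlgebra S) with
      mul_comm := fun x y => Subtype.ext (hcomm x x.2 y y.2) }
  by_contra! h
  apply ha
  apply (gelfandTransform_isometry S).injective
  rw [map_zero]
  ext φ
  exact h (WeakDual.CharacterSpace.toAlgHom φ) (map_continuous φ) (fun x => map_star φ x)

section IntegratedOperator

variable {G : Type*} [CommGroup G] [TopologicalSpace G] [IsTopologicalGroup G]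
  [CompactSpace G] [MeasurableSpace G] [BorelSpace G]
  {H : Type*} [NormedAddCommGroup H] [InnerProductSpace ℂ H] [CompleteSpace H]

theorem integrable_of_continuous_compact {E : Type*} [NormedAddCommGroup E] {μ : Measure G}
    [IsFiniteMeasureOnCompacts μ] {f : G → E} (hf : Continuous f) : Integrable f μ :=
  hf.integrable_of_hasCompactSupport (HasCompactSupport.of_compactSpace f)

theorem integrable_smul_apply {μ : Measure G} [IsFiniteMeasureOnCompacts μ]
    {U : G → (H →L[ℂ] H)} (hUc : ∀ v, Continuous fun y => U y v) (k : C(G, ℂ)) (v : H) :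
    Integrable (fun y => k y • U y v) μ :=
  integrable_of_continuous_compact (k.continuous.smul (hUc v))

/-- The operator `v ↦ ∫ k(y) U(y) v dy` associated with a strongly continuous isometric
representation `U` and a continuous function `k`. -/
noncomputable def integratedOp (μ : Measure G) [IsProbabilityMeasure μ]
    (U : G →* (H →L[ℂ] H)) (hU : ∀ y v, ‖U y v‖ = ‖v‖)
    (hUc : ∀ v, Continuous fun y => U y v) : C(G, ℂ) →L[ℂ] H →L[ℂ] H :=
  have hint := integrable_smul_apply (μ := μ) hUc
  LinearMap.mkContinuous₂
    (LinearMap.mk₂ ℂ (fun (k : C(G, ℂ)) (v : H) => ∫ y, k y • U y v ∂μ)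
      (fun k l v => by
        rw [← integral_add (hint k v) (hint l v)]; simp only [ContinuousMap.add_apply, add_smul])
      (fun c k v => by
        rw [← integral_smul]; simp only [ContinuousMap.smul_apply, smul_assoc])
      (fun k v w => by
        rw [← integral_add (hint k v) (hint k w)]; simp only [map_add, smul_add])
      (fun c k v => by
        rw [← integral_smul]; simp only [map_smul, smul_comm c])) 1
    (fun k v => by
      simp only [LinearMap.mk₂_apply, one_mul]
      refine (norm_integral_le_of_norm_le_const (C := ‖k‖ * ‖v‖) (ae_of_all _ fun y => ?_)).trans ?_
      · rw [norm_smul, hU]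
        gcongr
        exact k.norm_coe_le_norm y
      · simp)

variable {μ : Measure G} [IsProbabilityMeasure μ]
    {U : G →* (H →L[ℂ] H)} {hU : ∀ y v, ‖U y v‖ = ‖v‖} {hUc : ∀ v, Continuous fun y => U y v}

theorem integratedOp_apply (k : C(G, ℂ)) (v : H) :
    integratedOp μ U hU hUc k v = ∫ y, k y • U y v ∂μ := rfl

/-- The left translates of a continuous function. -/
noncomputable def leftTranslates (k : C(G, ℂ)) : C(G, C(G, ℂ)) :=
  (k.comp ⟨fun p : G × G => p.1⁻¹ * p.2, by fun_prop⟩).curry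

theorem leftTranslates_apply (k : C(G, ℂ)) (x y : G) : leftTranslates k x y = k (x⁻¹ * y) := rfl

/-- Invariance of `μ` moves the operator onto the kernel. Translates of `k` vary continuously in sup
norm, so `x ↦ U x * integratedOp k` is norm continuous even though `U` is only strongly continuous.
-/
theorem mul_integratedOp [μ.IsMulLeftInvariant] (x : G) (k : C(G, ℂ)) :
    U x * integratedOp μ U hU hUc k = integratedOp μ U hU hUc (leftTranslates k x) := by
  ext v
  rw [mul_apply_eq_comp, integratedOp_apply, integratedOp_apply,
    ← ContinuousLinearMap.integral_comp_comm _
      (integrable_smul_apply hUc k v),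
    ← integral_mul_left_eq_self (fun y => leftTranslates k x y • U y v) x]
  simp [leftTranslates_apply]

theorem commute_integratedOp {z : H →L[ℂ] H} (hz : ∀ y, U y * z = z * U y) (k : C(G, ℂ)) :
    integratedOp μ U hU hUc k * z = z * integratedOp μ U hU hUc k := by
  ext v
  rw [mul_apply_eq_comp, mul_apply_eq_comp, integratedOp_apply,
    integratedOp_apply, ← ContinuousLinearMap.integral_comp_comm _
      (integrable_smul_apply hUc k v)]
  congr 1
  ext y
  rw [map_smul, ← mul_apply_eq_comp, hz, mul_apply_eq_comp]

/-- A character of a commutative C⋆-algebra containing all `U x` and all integrated operators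
restricts to a unitary character of `G`; it is chosen not to kill `U x₀ * T k - T k`. -/
theorem exists_pontryaginDual_ne_one [μ.IsMulLeftInvariant] (hstar : ∀ y, star (U y) = U y⁻¹)
    (k : C(G, ℂ)) (x₀ : G)
    (hk : U x₀ * integratedOp μ U hU hUc k ≠ integratedOp μ U hU hUc k) :
    ∃ χ : PontryaginDual G, χ x₀ ≠ 1 := by
  set T := integratedOp μ U hU hUc with hT
  -- `S` is the bicommutant of the range of `U`. It is commutative: `G` is abelian, so each `U x`
  -- lies in `C`, whence `S ⊆ C`.
  let C := StarSubalgebra.centralizer ℂ (Set.range U)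
  let S := StarSubalgebra.centralizer ℂ (C : Set (H →L[ℂ] H))
  have hCmem : ∀ z, z ∈ C ↔ ∀ y, U y * z = z * U y := fun z => by
    rw [StarSubalgebra.mem_centralizer_iff]
    refine ⟨fun h y => (h _ ⟨y, rfl⟩).1, ?_⟩
    rintro h _ ⟨y, rfl⟩
    exact ⟨h y, by rw [hstar]; exact h _⟩
  have hSmem : ∀ w, w ∈ S ↔ ∀ z ∈ C, z * w = w * z := fun w => by
    rw [StarSubalgebra.mem_centralizer_iff]
    exact ⟨fun h z hz => (h z hz).1, fun h z hz => ⟨h z hz, h _ (star_mem hz)⟩⟩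
  have hUC : ∀ x, U x ∈ C := fun x => (hCmem _).2 fun y => by
    rw [← map_mul, ← map_mul, mul_comm]
  have hUS : ∀ x, U x ∈ S := fun x => (hSmem _).2 fun z hz => ((hCmem z).1 hz x).symm
  have hTS : ∀ l, T l ∈ S := fun l => (hSmem _).2 fun z hz =>
    (commute_integratedOp ((hCmem z).1 hz) l).symm
  have hSC : ∀ w ∈ S, w ∈ C := fun w hw => (hCmem w).2 fun y => (hSmem w).1 hw _ (hUC y)
  have hcl : IsClosed (S : Set (H →L[ℂ] H)) := by
    have : (S : Set (H →L[ℂ] H)) = ⋂ z ∈ C, {w | z * w = w * z} := by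
      ext w; simp [hSmem]
    rw [this]
    exact isClosed_biInter fun z _ => isClosed_eq (by fun_prop) (by fun_prop)
  let u : G → S := fun x => ⟨U x, hUS x⟩
  let t : S := ⟨T k, hTS k⟩
  have hne : u x₀ * t - t ≠ 0 := fun h => hk (congrArg Subtype.val (sub_eq_zero.1 h))
  obtain ⟨φ, hφc, hφs, hφ⟩ := exists_character_ne_zero S hcl
    (fun x hx y hy => (hSmem y).1 hy x (hSC x hx)) hne
  have hφ' : (φ (u x₀) - 1) * φ t ≠ 0 := by
    rwa [map_sub, map_mul, ← sub_one_mul] at hφ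
  have ht : φ t ≠ 0 := right_ne_zero_of_mul hφ'
  have hu1 : u 1 = 1 := Subtype.ext (map_one U)
  have hum : ∀ x y, u (x * y) = u x * u y := fun x y => Subtype.ext (map_mul U x y)
  have hustar : ∀ x, star (u x) = u x⁻¹ := fun x => Subtype.ext (hstar x)
  have hnorm : ∀ x, φ (u x) ∈ Submonoid.unitSphere ℂ := fun x => by
    have h1 : φ (u x) * star (φ (u x)) = 1 := by
      rw [← hφs, hustar, ← map_mul, ← hum, mul_inv_cancel, hu1, map_one]
    rw [Submonoid.unitSphere, ← SetLike.mem_coe]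
    change φ (u x) ∈ Metric.sphere (0 : ℂ) 1
    rw [mem_sphere_zero_iff_norm]
    have h2 := congrArg norm h1
    rw [norm_mul, norm_star, norm_one] at h2
    nlinarith [norm_nonneg (φ (u x))]
  -- `φ` is only norm continuous, so continuity is read off from `φ (u x * t)` and then divided by
  -- `φ t ≠ 0`.
  have hcont : Continuous fun x => φ (u x) := by
    have h1 : Continuous fun x => φ (u x * t) := by
      refine hφc.comp (Continuous.subtype_mk (f := fun x => U x * T k) ?_ _)
      simp only [hT, mul_integratedOp]
      fun_prop
    simp only [map_mul] at h1
    simpa [ht] using h1.div_const (φ t)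
  let χ : G →ₜ* Circle :=
    { toFun := fun x => ⟨φ (u x), hnorm x⟩
      map_one' := by apply Subtype.ext; simp [hu1]
      map_mul' := fun x y => Subtype.ext ((congrArg φ (hum x y)).trans (map_mul φ _ _))
      continuous_toFun := Continuous.subtype_mk hcont _ }
  refine ⟨χ, fun h => left_ne_zero_of_mul hφ' ?_⟩
  rw [sub_eq_zero]
  exact congrArg Subtype.val h

end IntegratedOperator

/-! ### Characters separate points; density of trigonometric polynomials -/

section Separation

variable {G : Type*} [CommGroup G] [TopologicalSpace G] [IsTopologicalGroup G]
  [CompactSpace G] [T2Space G] [MeasurableSpace G] [BorelSpace G]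
  (μ : Measure G) [μ.IsHaarMeasure] [μ.Regular] [IsProbabilityMeasure μ]

/-- The translation operators on `L²`. -/
noncomputable def translationL2 : G →* (Lp ℂ 2 μ →L[ℂ] Lp ℂ 2 μ) where
  toFun y := (Lp.compMeasurePreservingₗᵢ ℂ (y * ·)
    (measurePreserving_mul_left μ y)).toContinuousLinearMap
  map_one' := by
    ext1 v
    exact one_smul (Gᵈᵐᵃ) v
  map_mul' x y := by
    ext1 v
    rw [mul_comm x y]
    exact mul_smul (DomMulAct.mk x) (DomMulAct.mk y) v

theorem translationL2_apply (y : G) (v : Lp ℂ 2 μ) :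
    translationL2 μ y v = DomMulAct.mk y • v := rfl

theorem norm_translationL2 (y : G) (v : Lp ℂ 2 μ) : ‖translationL2 μ y v‖ = ‖v‖ :=
  LinearIsometry.norm_map _ v

theorem continuous_translationL2 (v : Lp ℂ 2 μ) : Continuous fun y => translationL2 μ y v := by
  simp only [translationL2_apply]
  have : Fact ((2 : ℝ≥0∞) ≠ ∞) := ⟨by simp⟩
  have h : Continuous (DomMulAct.mk : G → Gᵈᵐᵃ) := DomMulAct.continuous_mk
  exact h.smul continuous_const

theorem star_translationL2 (y : G) : star (translationL2 μ y) = translationL2 μ y⁻¹ := by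
  have h1 : star (translationL2 μ y) * translationL2 μ y = 1 := by
    refine (ContinuousLinearMap.norm_map_iff_adjoint_comp_self _).1 (norm_translationL2 μ y)
  have h2 : translationL2 μ y * translationL2 μ y⁻¹ = 1 := by
    rw [← map_mul, mul_inv_cancel, map_one]
  calc _ = star (translationL2 μ y) * (translationL2 μ y * translationL2 μ y⁻¹) := by
        rw [h2, mul_one]
    _ = _ := by rw [← mul_assoc, h1, one_mul]

/-- The integrated operators of the translation representation are faithful. -/
theorem integratedOp_translationL2_injective {k : C(G, ℂ)}
    (hk : integratedOp μ (translationL2 μ) (norm_translationL2 μ)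
      (continuous_translationL2 μ) k = 0) : k = 0 := by
  -- The operator is tested on `star k`. The integral is formed in `C(G, ℂ)`, so it can be evaluated
  -- at `1`, where it equals `∫ ‖k‖²`.
  let w : C(G, C(G, ℂ)) := ((star k).comp ⟨fun p : G × G => p.1 * p.2, by fun_prop⟩).curry
  have hw : ∀ y z, w y z = star (k (y * z)) := fun y z => rfl
  have hint : Integrable (fun y => k y • w y) μ :=
    integrable_of_continuous_compact (k.continuous.smul w.continuous)
  have h0 : ContinuousMap.toLp (E := ℂ) 2 μ ℂ (∫ y, k y • w y ∂μ) = 0 := by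
    rw [← ContinuousLinearMap.integral_comp_comm _ hint]
    have := congrArg (fun A => A (ContinuousMap.toLp (E := ℂ) 2 μ ℂ (star k))) hk
    simp only [integratedOp_apply, zero_apply] at this
    rw [← this]
    simp only [map_smul]
    rfl
  have h1 : ∫ y, k y • w y ∂μ = 0 := by
    apply ContinuousMap.toLp_injective (p := 2) (𝕜 := ℂ) μ
    rw [h0, map_zero]
  have h2 : ∫ y, ‖k y‖ ^ 2 ∂μ = 0 := by
    have := congrArg (ContinuousMap.evalCLM ℂ (1 : G)) h1
    rw [← ContinuousLinearMap.integral_comp_comm _ hint] at this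
    simp only [ContinuousMap.evalCLM_apply, ContinuousMap.smul_apply, hw, mul_one, map_zero] at this
    have h3 : ∀ y, k y • star (k y) = ((‖k y‖ ^ 2 : ℝ) : ℂ) := fun y => by
      rw [smul_eq_mul, Complex.star_def, Complex.mul_conj, Complex.normSq_eq_norm_sq]
    simp only [h3] at this
    rw [integral_complex_ofReal] at this
    exact_mod_cast this
  have hc : Continuous fun y => ‖k y‖ ^ 2 := by fun_prop
  rw [integral_eq_zero_iff_of_nonneg (fun y => by positivity)
    (integrable_of_continuous_compact hc)] at h2
  have h4 := (Continuous.ae_eq_iff_eq μ hc continuous_zero).1 h2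
  ext y
  simpa using congrFun h4 y

/-- Characters of a compact abelian group separate points. -/
theorem exists_pontryaginDual_apply_ne_one (μ : Measure G) [μ.IsHaarMeasure] [μ.Regular]
    [IsProbabilityMeasure μ] {x₀ : G} (hx : x₀ ≠ 1) :
    ∃ χ : PontryaginDual G, χ x₀ ≠ 1 := by
  -- At `1` the function `k` equals `1`, while its translate by `x₀` equals `k x₀⁻¹ = 0`;
  -- faithfulness then makes the two integrated operators differ.
  obtain ⟨g, hg1, hg0, -⟩ := exists_continuous_one_zero_of_isCompact
    (isCompact_singleton (x := (1 : G))) (isClosed_singleton (x := x₀⁻¹))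
    (by simpa using hx)
  let k : C(G, ℂ) := ⟨fun y => (g y : ℂ), by fun_prop⟩
  refine exists_pontryaginDual_ne_one (μ := μ) (hU := norm_translationL2 μ)
    (hUc := continuous_translationL2 μ) (star_translationL2 μ) k x₀ fun h => ?_
  rw [mul_integratedOp, ← sub_eq_zero, ← map_sub] at h
  have := congrArg (fun f : C(G, ℂ) => f 1) (integratedOp_translationL2_injective μ h)
  have e1 : g 1 = 1 := hg1 rfl
  have e0 : g x₀⁻¹ = 0 := hg0 rfl
  simp [leftTranslates_apply, k, e1, e0] at this

/-- A character as a continuous complex function. -/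
noncomputable def charFun (χ : PontryaginDual G) : C(G, ℂ) :=
  ⟨fun x => ((χ x : Circle) : ℂ), by fun_prop⟩

theorem charFun_apply (χ : PontryaginDual G) (x : G) : charFun χ x = ((χ x : Circle) : ℂ) := rfl

/-- Trigonometric polynomials are dense in the continuous functions. -/
theorem dense_span_charFun (μ : Measure G) [μ.IsHaarMeasure] [μ.Regular]
    [IsProbabilityMeasure μ] :
    (Submodule.span ℂ (Set.range (charFun (G := G)))).topologicalClosure = ⊤ := by
  let M : Submonoid C(G, ℂ) :=
    { carrier := Set.range charFun
      one_mem' := ⟨1, by ext x; simp [charFun_apply]⟩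
      mul_mem' := by
        rintro _ _ ⟨χ, rfl⟩ ⟨χ', rfl⟩
        exact ⟨χ * χ', by ext x; simp [charFun_apply]; rfl⟩ }
  let A : StarSubalgebra ℂ C(G, ℂ) :=
    { Algebra.adjoin ℂ (M : Set C(G, ℂ)) with
      star_mem' := by
        intro a ha
        change star a ∈ Algebra.adjoin ℂ (M : Set C(G, ℂ))
        change a ∈ Algebra.adjoin ℂ (M : Set C(G, ℂ)) at ha
        induction ha using Algebra.adjoin_induction with
        | mem x hx =>
          obtain ⟨χ, rfl⟩ := hx
          refine Algebra.subset_adjoin ⟨χ⁻¹, ?_⟩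
          ext x
          change (((χ x)⁻¹ : Circle) : ℂ) = star ((χ x : Circle) : ℂ)
          rw [Circle.coe_inv_eq_conj]; rfl
        | algebraMap r =>
          rw [← algebraMap_star_comm]
          exact Subalgebra.algebraMap_mem _ _
        | add x y _ _ hx hy => rw [star_add]; exact add_mem hx hy
        | mul x y _ _ hx hy => rw [star_mul]; exact mul_mem hy hx }
  have hA : A.toSubalgebra.SeparatesPoints := by
    intro x y hxy
    obtain ⟨χ, hχ⟩ := exists_pontryaginDual_apply_ne_one μ
      (x₀ := x * y⁻¹) (by rwa [Ne, mul_inv_eq_one])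
    refine ⟨charFun χ, ⟨charFun χ, Algebra.subset_adjoin ⟨χ, rfl⟩, rfl⟩, fun h => hχ ?_⟩
    have : χ x = χ y := Subtype.ext h
    rw [map_mul, map_inv, this, mul_inv_cancel]
  have h := ContinuousMap.starSubalgebra_topologicalClosure_eq_top_of_separatesPoints A hA
  rw [eq_top_iff]
  intro f _
  have hf : f ∈ closure (A : Set C(G, ℂ)) := by
    rw [← StarSubalgebra.topologicalClosure_coe, h]; trivial
  -- Characters are closed under products, so the algebra they generate is just their linear span.
  have hA' : (A : Set C(G, ℂ)) = Submodule.span ℂ (Set.range (charFun (G := G))) := by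
    change (Algebra.adjoin ℂ (M : Set C(G, ℂ)) : Set C(G, ℂ)) = _
    rw [← Subalgebra.coe_toSubmodule, Algebra.adjoin_eq_span, Submonoid.closure_eq]
    rfl
  rw [hA'] at hf
  exact hf

end Separation

/-! ### Uniqueness of Fourier coefficients in `L¹` -/

section Uniqueness

/-- An integrable function which is orthogonal to all continuous functions vanishes. -/
theorem ae_eq_zero_of_forall_integral_continuous_mul {X : Type*} [TopologicalSpace X]
    [CompactSpace X] [T2Space X] [MeasurableSpace X] [BorelSpace X] {μ : Measure X}
    [IsFiniteMeasure μ] [μ.Regular] {f : X → ℂ} (hf : Integrable f μ)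
    (h : ∀ u : C(X, ℂ), ∫ x, u x * f x ∂μ = 0) : f =ᵐ[μ] 0 := by
  apply ae_eq_zero_of_forall_setIntegral_isCompact_eq_zero hf
  intro K hK
  rw [← norm_le_zero_iff]
  refine le_of_forall_pos_le_add fun ε hε => ?_
  rw [zero_add]
  -- Absolute continuity of `∫ ‖f‖` gives `δ`; outer regularity gives `U` with `μ (U \ K) < δ`. A
  -- Urysohn function for `K ⊆ U` differs from the indicator of `K` only on `U \ K`.
  obtain ⟨δ, hδ, hδε⟩ := exists_pos_setLIntegral_lt_of_measure_lt
    (f := fun x => ‖f x‖ₑ) hf.2.ne (ε := ENNReal.ofReal ε) (by simpa using hε)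
  obtain ⟨U, hKU, hU, hμU⟩ := hK.exists_isOpen_lt_add (μ := μ) hδ.ne'
  obtain ⟨g, hg1, hg0, -, hg⟩ := exists_continuous_one_zero_of_isCompact hK hU.isClosed_compl
    (Set.disjoint_compl_right_iff_subset.2 hKU)
  have hd : μ (U \ K) < δ := by
    rw [measure_sdiff hKU hK.measurableSet.nullMeasurableSet hK.measure_lt_top.ne]
    exact ENNReal.sub_lt_of_lt_add (measure_mono hKU) (by rwa [add_comm] at hμU)
  have h2 := hδε (U \ K) hd
  let u : C(X, ℂ) := ⟨fun y => (g y : ℂ), by fun_prop⟩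
  have hui : Integrable (fun x => u x * f x) μ := by
    refine hf.bdd_mul (c := 1) u.continuous.aestronglyMeasurable (ae_of_all _ fun x => ?_)
    simp [u, abs_of_nonneg (hg x).1, (hg x).2]
  have hKi : Integrable (K.indicator f) μ := hf.indicator hK.measurableSet
  have h3 : ∫ x in K, f x ∂μ = ∫ x, (K.indicator f x - u x * f x) ∂μ := by
    rw [integral_sub hKi hui, h u, sub_zero, integral_indicator hK.measurableSet]
  have hmeas : MeasurableSet (U \ K) := hU.measurableSet.diff hK.measurableSet
  have h4 : ∀ x, ‖K.indicator f x - u x * f x‖ₑ ≤ (U \ K).indicator (fun x => ‖f x‖ₑ) x := by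
    intro x
    by_cases hxK : x ∈ K
    · have : g x = 1 := hg1 hxK
      simp [hxK, u, this]
    · by_cases hxU : x ∈ U
      · simp only [hxK, hxU, Set.indicator_of_notMem, not_false_eq_true, zero_sub, enorm_neg,
          Set.mem_sdiff, and_self, Set.indicator_of_mem]
        rw [enorm_mul]
        have : ‖u x‖ₑ ≤ 1 := by
          rw [← ofReal_norm, ENNReal.ofReal_le_one]
          simp [u, abs_of_nonneg (hg x).1, (hg x).2]
        exact mul_le_of_le_one_left bot_le this
      · have : g x = 0 := hg0 hxU
        simp [hxK, hxU, u, this]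
  have h5 : ‖∫ x in K, f x ∂μ‖ₑ ≤ ENNReal.ofReal ε := by
    rw [h3]
    calc _ ≤ ∫⁻ x, ‖K.indicator f x - u x * f x‖ₑ ∂μ := enorm_integral_le_lintegral_enorm _
      _ ≤ ∫⁻ x, (U \ K).indicator (fun x => ‖f x‖ₑ) x ∂μ := lintegral_mono h4
      _ = ∫⁻ x in U \ K, ‖f x‖ₑ ∂μ := lintegral_indicator hmeas _
      _ ≤ _ := h2.le
  rw [← ofReal_norm] at h5
  exact (ENNReal.ofReal_le_ofReal_iff hε.le).1 h5

variable {G : Type*} [CommGroup G] [TopologicalSpace G] [IsTopologicalGroup G]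
  [CompactSpace G] [T2Space G] [MeasurableSpace G] [BorelSpace G]
  {μ : Measure G} [μ.IsHaarMeasure] [μ.Regular] [IsProbabilityMeasure μ]

/-- Uniqueness of Fourier coefficients for integrable functions. -/
theorem ae_eq_zero_of_fourierCoeff_eq_zero {f : G → ℂ} (hf : Integrable f μ)
    (h : ∀ γ : PontryaginDual G, fourierCoeff μ f γ = 0) : f =ᵐ[μ] 0 := by
  apply ae_eq_zero_of_forall_integral_continuous_mul hf
  have hint : ∀ u : C(G, ℂ), Integrable (fun x => u x * f x) μ := fun u =>
    hf.bdd_mul (c := ‖u‖) u.continuous.aestronglyMeasurable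
      (ae_of_all _ fun x => u.norm_coe_le_norm x)
  let Φ : C(G, ℂ) →L[ℂ] ℂ := LinearMap.mkContinuous
    { toFun := fun u => ∫ x, u x * f x ∂μ
      map_add' := fun u v => by
        rw [← integral_add (hint u) (hint v)]; simp only [ContinuousMap.add_apply, add_mul]
      map_smul' := fun c u => by
        simp only [ContinuousMap.smul_apply, smul_eq_mul, mul_assoc, integral_const_mul,
          RingHom.id_apply] } (∫ x, ‖f x‖ ∂μ)
    (fun u => by
      refine (norm_integral_le_integral_norm _).trans ?_
      rw [mul_comm, ← integral_const_mul]
      refine integral_mono (hint u).norm (hf.norm.const_mul _) fun x => ?_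
      simp only [norm_mul]
      gcongr
      exact u.norm_coe_le_norm x)
  have hker : (Submodule.span ℂ (Set.range (charFun (G := G)))).topologicalClosure
      ≤ LinearMap.ker Φ.toLinearMap := by
    refine Submodule.topologicalClosure_minimal _ (Submodule.span_le.2 ?_) Φ.isClosed_ker
    rintro _ ⟨χ, rfl⟩
    change ∫ x, charFun χ x * f x ∂μ = 0
    rw [← h χ⁻¹]
    refine integral_congr_ae (ae_of_all _ fun x => ?_)
    change ((χ x : Circle) : ℂ) * f x = f x * (starRingEnd ℂ) (((χ x)⁻¹ : Circle) : ℂ)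
    rw [Circle.coe_inv_eq_conj, Complex.conj_conj, mul_comm]
  intro u
  have : u ∈ LinearMap.ker Φ.toLinearMap := hker (by rw [dense_span_charFun μ]; trivial)
  exact this

end Uniqueness

theorem IsFrequency.finite_setOf_fourierLine_ne_zero {lam : ℕ → ℝ} (hlam : IsFrequency lam)
    {ψ : ℝ → ℂ} (hψ : HasCompactSupport (fourierLine ψ)) :
    {n | fourierLine ψ (lam n) ≠ 0}.Finite := by
  obtain ⟨R, hR⟩ := hψ.isCompact.isBounded.bddAbove
  obtain ⟨N, hN⟩ := (hlam.tendsto_atTop.eventually_gt_atTop R).exists_forall_of_atTop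
  refine (Set.finite_lt_nat N).subset fun n hn => ?_
  by_contra h
  exact absurd (hR (subset_tsupport _ hn)) (not_le.2 (hN n (not_lt.1 h)))

/-! ### The identity on a Dirichlet group -/

section Group

variable {G : Type*} [CommGroup G] [TopologicalSpace G]

theorem IsDirichletGroup.char_injective {lam : ℕ → ℝ} (hlam : IsFrequency lam)
    {β : Multiplicative ℝ →ₜ* G} (hβ : IsDirichletGroup lam β) :
    Function.Injective hβ.char := by
  intro m n h
  by_contra hmn
  have hne : lam m - lam n ≠ 0 := sub_ne_zero.2 (hlam.strictMono.injective.ne hmn)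
  -- At `t = π / (lam m - lam n)` the two exponentials are opposite, so they cannot agree.
  have key : Complex.exp (-Complex.I * (lam m : ℂ) * ((Real.pi / (lam m - lam n) : ℝ) : ℂ))
      = Complex.exp (-Complex.I * (lam n : ℂ) * ((Real.pi / (lam m - lam n) : ℝ) : ℂ)) := by
    rw [← hβ.char_apply, ← hβ.char_apply, h]
  have hd : -Complex.I * (lam m : ℂ) * ((Real.pi / (lam m - lam n) : ℝ) : ℂ)
      = -Complex.I * (lam n : ℂ) * ((Real.pi / (lam m - lam n) : ℝ) : ℂ)
        + -(Real.pi * Complex.I) := by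
    have hne' : (lam m : ℂ) - lam n ≠ 0 := by exact_mod_cast hne
    push_cast
    field_simp
    ring
  rw [hd, Complex.exp_add, Complex.exp_neg, Complex.exp_pi_mul_I] at key
  have h0 := Complex.exp_ne_zero (-Complex.I * (lam n : ℂ) * ((Real.pi / (lam m - lam n) : ℝ) : ℂ))
  have : (2 : ℂ) * Complex.exp (-Complex.I * (lam n : ℂ)
      * ((Real.pi / (lam m - lam n) : ℝ) : ℂ)) = 0 := by
    linear_combination -key
  simp at this

variable [IsTopologicalGroup G] [CompactSpace G] [T2Space G] [MeasurableSpace G] [BorelSpace G]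
  {μ : Measure G} [μ.IsHaarMeasure] [μ.Regular] [IsProbabilityMeasure μ]

theorem integral_char_eq_zero {χ : PontryaginDual G} (hχ : χ ≠ 1) :
    ∫ ω, ((χ ω : Circle) : ℂ) ∂μ = 0 := by
  obtain ⟨x, hx⟩ : ∃ x, χ x ≠ 1 := by
    by_contra! h
    exact hχ (PontryaginDual.ext h)
  have h := integral_mul_left_eq_self (μ := μ) (fun ω => ((χ ω : Circle) : ℂ)) x
  simp only [map_mul, Circle.coe_mul] at h
  rw [integral_const_mul] at h
  have h1 : (((χ x : Circle) : ℂ) - 1) * ∫ ω, ((χ ω : Circle) : ℂ) ∂μ = 0 := by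
    rw [sub_mul, h, one_mul, sub_self]
  refine (mul_eq_zero.1 h1).resolve_left fun h2 => hx ?_
  apply Subtype.ext
  exact sub_eq_zero.1 h2

theorem fourierCoeff_char (χ γ : PontryaginDual G) [Decidable (χ = γ)] :
    fourierCoeff μ (fun ω => ((χ ω : Circle) : ℂ)) γ = if χ = γ then 1 else 0 := by
  have h : fourierCoeff μ (fun ω => ((χ ω : Circle) : ℂ)) γ
      = ∫ ω, (((χ * γ⁻¹) ω : Circle) : ℂ) ∂μ := by
    refine integral_congr_ae (ae_of_all _ fun ω => ?_)
    change ((χ ω : Circle) : ℂ) * _ = ((χ ω * (γ ω)⁻¹ : Circle) : ℂ)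
    rw [Circle.coe_mul, Circle.coe_inv_eq_conj]
  rw [h]
  split_ifs with hc
  · rw [hc, mul_inv_cancel]
    simp [PontryaginDual.one_apply]
  · exact integral_char_eq_zero (by rwa [Ne, mul_inv_eq_one])

theorem integrable_mul_conj_char {f : G → ℂ} (hf : Integrable f μ) (γ : PontryaginDual G) :
    Integrable (fun ω => f ω * (starRingEnd ℂ) ((γ ω : Circle) : ℂ)) μ := by
  refine hf.mul_bdd (c := 1) ?_ (ae_of_all _ fun x => ((RCLike.norm_conj _).trans (Circle.norm_coe _)).le)
  exact Continuous.aestronglyMeasurable (by fun_prop)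

theorem fourierCoeff_finset_sum {ι : Type*} (s : Finset ι) (c : ι → ℂ)
    (h : ι → PontryaginDual G) (γ : PontryaginDual G) :
    fourierCoeff μ (fun ω => ∑ i ∈ s, c i * ((h i ω : Circle) : ℂ)) γ
      = ∑ i ∈ s, c i * fourierCoeff μ (fun ω => ((h i ω : Circle) : ℂ)) γ := by
  unfold fourierCoeff
  simp_rw [Finset.sum_mul, mul_assoc]
  rw [integral_finsetSum]
  · simp_rw [integral_const_mul]
  · intro i _
    exact (integrable_mul_conj_char
      (integrable_of_continuous_compact (by fun_prop)) γ).const_mul _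

theorem fourierCoeff_translate (f : G → ℂ) (b : G) (γ : PontryaginDual G) :
    ∫ ω, f (ω * b) * (starRingEnd ℂ) ((γ ω : Circle) : ℂ) ∂μ
      = ((γ b : Circle) : ℂ) * fourierCoeff μ f γ := by
  rw [fourierCoeff, ← integral_mul_right_eq_self (fun ω => f ω * (starRingEnd ℂ) ((γ ω : Circle) : ℂ)) b, ← integral_const_mul]
  refine integral_congr_ae (ae_of_all _ fun ω => ?_)
  have h : ((γ b : Circle) : ℂ) * (starRingEnd ℂ) ((γ b : Circle) : ℂ) = 1 := by
    rw [Complex.mul_conj]; simp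
  simp only [map_mul, Circle.coe_mul]
  linear_combination (-(f (ω * b) * (starRingEnd ℂ) ((γ ω : Circle) : ℂ))) * h

/-- The skew product `(t, ω) ↦ (t, ω β(t))` preserves the product measure, each fibre map being a
translation; it carries the integrable `ψ ⊗ f` to the integrand. -/
theorem integrable_flow {ψ : ℝ → ℂ} (hψ : Integrable ψ volume) (β : Multiplicative ℝ →ₜ* G)
    {f : G → ℂ} (hf : Integrable f μ) :
    Integrable (fun p : ℝ × G => f (p.2 * β (Multiplicative.ofAdd p.1)) * ψ p.1)
      (volume.prod μ) := by
  have hb : Continuous fun t : ℝ => β (Multiplicative.ofAdd t) :=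
    (map_continuous β).comp continuous_ofAdd
  have hmp : MeasurePreserving (fun p : ℝ × G => (p.1, p.2 * β (Multiplicative.ofAdd p.1)))
      (volume.prod μ) (volume.prod μ) := by
    refine (MeasurePreserving.id volume).skew_product (g := fun t ω =>
      ω * β (Multiplicative.ofAdd t)) ?_ (ae_of_all _ fun t => map_mul_right_eq_self μ _)
    exact (show Continuous fun p : ℝ × G => p.2 * β (Multiplicative.ofAdd p.1) from
      continuous_snd.mul (hb.comp continuous_fst)).measurable
  have := hmp.integrable_comp_of_integrable (hψ.mul_prod hf)
  simpa only [Function.comp_def, mul_comm] using this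

theorem fourierCoeff_flow {ψ : ℝ → ℂ} (hψ : Integrable ψ volume) (β : Multiplicative ℝ →ₜ* G)
    {f : G → ℂ} (hf : Integrable f μ) (γ : PontryaginDual G) :
    fourierCoeff μ (fun ω => ∫ t : ℝ, f (ω * β (Multiplicative.ofAdd t)) * ψ t) γ
      = fourierCoeff μ f γ * ∫ t : ℝ, ψ t * ((γ (β (Multiplicative.ofAdd t)) : Circle) : ℂ) := by
  have hF := integrable_flow (μ := μ) hψ β hf
  have hF' : Integrable (fun p : ℝ × G => f (p.2 * β (Multiplicative.ofAdd p.1)) * ψ p.1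
      * (starRingEnd ℂ) ((γ p.2 : Circle) : ℂ)) (volume.prod μ) := by
    refine hF.mul_bdd (c := 1) ?_ (ae_of_all _ fun x => ((RCLike.norm_conj _).trans (Circle.norm_coe _)).le)
    exact Continuous.aestronglyMeasurable (by fun_prop)
  rw [fourierCoeff]
  simp_rw [← integral_mul_const]
  rw [← integral_integral_swap (f := fun t ω => f (ω * β (Multiplicative.ofAdd t)) * ψ t
      * (starRingEnd ℂ) ((γ ω : Circle) : ℂ)) hF', ← integral_const_mul]
  refine integral_congr_ae (ae_of_all _ fun t => ?_)
  simp only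
  have := fourierCoeff_translate (μ := μ) f (β (Multiplicative.ofAdd t)) γ
  calc _ = ψ t * ∫ ω, f (ω * β (Multiplicative.ofAdd t))
        * (starRingEnd ℂ) ((γ ω : Circle) : ℂ) ∂μ := by
        rw [← integral_const_mul]
        congr 1; ext ω; ring
    _ = _ := by rw [this]; ring

theorem hasSum_flow_of_memHardy {ψ : ℝ → ℂ} (hψ : Integrable ψ volume)
    (hψ_supp : HasCompactSupport (fourierLine ψ)) {lam : ℕ → ℝ} (hlam : IsFrequency lam)
    {β : Multiplicative ℝ →ₜ* G} (hβ : IsDirichletGroup lam β) {f : G → ℂ}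
    (hf : MemHardy hβ 1 μ f) :
    ∀ᵐ ω ∂μ,
      Integrable (fun t : ℝ => f (ω * β (Multiplicative.ofAdd t)) * ψ t) volume ∧
      HasSum
        (fun n : ℕ => fourierCoeff μ f (hβ.char n)
          * fourierLine ψ (lam n) * ((hβ.char n ω : Circle) : ℂ))
        (∫ t : ℝ, f (ω * β (Multiplicative.ofAdd t)) * ψ t) := by
  classical
  have hfi : Integrable f μ := memLp_one_iff_integrable.1 hf.1
  have hF := integrable_flow (μ := μ) hψ β hfi
  let s : Finset ℕ := (hlam.finite_setOf_fourierLine_ne_zero hψ_supp).toFinset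
  have hs : ∀ n ∉ s, fourierLine ψ (lam n) = 0 := fun n hn => by
    by_contra h
    exact hn ((hlam.finite_setOf_fourierLine_ne_zero hψ_supp).mem_toFinset.2 h)
  let c : ℕ → ℂ := fun n => fourierCoeff μ f (hβ.char n) * fourierLine ψ (lam n)
  let P : G → ℂ := fun ω => ∑ n ∈ s, c n * ((hβ.char n ω : Circle) : ℂ)
  let g : G → ℂ := fun ω => ∫ t : ℝ, f (ω * β (Multiplicative.ofAdd t)) * ψ t
  have hPi : Integrable P μ := integrable_of_continuous_compact (by fun_prop)
  have hgi : Integrable g μ := hF.integral_prod_right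
  have hchar : ∀ n, ∫ t : ℝ, ψ t * ((hβ.char n (β (Multiplicative.ofAdd t)) : Circle) : ℂ)
      = fourierLine ψ (lam n) := fun n => by
    unfold fourierLine
    congr 1; ext t
    rw [hβ.char_apply, mul_right_comm]
  -- At `hβ.char n`, injectivity of `hβ.char` isolates one term of `P`; off the range both sides
  -- vanish by the Hardy condition.
  have hcoeff : ∀ γ, fourierCoeff μ g γ = fourierCoeff μ P γ := fun γ => by
    rw [fourierCoeff_flow hψ β hfi, fourierCoeff_finset_sum]
    simp_rw [fourierCoeff_char]
    by_cases hγ : γ ∈ Set.range hβ.char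
    · obtain ⟨n, rfl⟩ := hγ
      rw [hchar]
      simp only [(hβ.char_injective hlam).eq_iff, mul_ite, mul_one, mul_zero,
        Finset.sum_ite_eq']
      split_ifs with hn
      · rfl
      · rw [hs n hn, mul_zero]
    · rw [hf.2 γ hγ, zero_mul]
      symm
      refine Finset.sum_eq_zero fun n _ => ?_
      rw [if_neg (fun h => hγ ⟨n, h⟩), mul_zero]
  have hsub : (fun ω => g ω - P ω) =ᵐ[μ] 0 := by
    refine ae_eq_zero_of_fourierCoeff_eq_zero (hgi.sub hPi) fun γ => ?_
    have h := hcoeff γ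
    rw [← sub_eq_zero] at h
    rw [← h]
    unfold fourierCoeff
    rw [← integral_sub (integrable_mul_conj_char hgi γ) (integrable_mul_conj_char hPi γ)]
    simp only [sub_mul]
  filter_upwards [hF.prod_left_ae, hsub] with ω h1 h2
  refine ⟨h1, ?_⟩
  have h3 : g ω = P ω := sub_eq_zero.1 h2
  change HasSum _ (g ω)
  rw [h3]
  refine hasSum_sum_of_ne_finset_zero fun n hn => ?_
  rw [hs n hn, mul_zero, zero_mul]

end Group

/-! ### Abel summation for Dirichlet series -/

section Abel

/-- The difference is an integral of `z exp(-u z)`, whose norm is `‖z‖ exp(-u re z)`. The bound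
keeps the form of a difference so that it telescopes over `n`. -/
theorem norm_exp_sub_exp_le {z : ℂ} (hz : 0 < z.re) {x y : ℝ} (hxy : x ≤ y) :
    ‖Complex.exp (-(x : ℂ) * z) - Complex.exp (-(y : ℂ) * z)‖
      ≤ ‖z‖ / z.re * (Real.exp (-x * z.re) - Real.exp (-y * z.re)) := by
  have h1 : ∫ u in x..y, -z * Complex.exp (-(u : ℂ) * z)
      = Complex.exp (-(y : ℂ) * z) - Complex.exp (-(x : ℂ) * z) := by
    refine intervalIntegral.integral_eq_sub_of_hasDerivAt
      (f := fun u : ℝ => Complex.exp (-(u : ℂ) * z)) (fun u _ => ?_)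
      (Continuous.intervalIntegrable (by fun_prop) _ _)
    refine (((Complex.ofRealCLM.hasDerivAt (x := u)).neg).mul_const z).cexp.congr_deriv ?_
    simp [mul_comm]
  have h2 : ∫ u in x..y, ‖z‖ * Real.exp (-u * z.re)
      = (-(‖z‖ / z.re) * Real.exp (-y * z.re)) - (-(‖z‖ / z.re) * Real.exp (-x * z.re)) := by
    refine intervalIntegral.integral_eq_sub_of_hasDerivAt
      (f := fun u : ℝ => -(‖z‖ / z.re) * Real.exp (-u * z.re)) (fun u _ => ?_)
      (Continuous.intervalIntegrable (by fun_prop) _ _)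
    refine (((((hasDerivAt_id u).neg).mul_const z.re).exp).const_mul
      (-(‖z‖ / z.re))).congr_deriv ?_
    simp only [id, Pi.neg_apply]
    field_simp
  rw [norm_sub_rev, ← h1]
  refine (intervalIntegral.norm_integral_le_of_norm_le hxy
    (g := fun u => ‖z‖ * Real.exp (-u * z.re)) (ae_of_all _ fun u _ => ?_)
    (Continuous.intervalIntegrable (by fun_prop) _ _)).trans ?_
  · rw [norm_mul, norm_neg, Complex.norm_exp]
    simp
  · rw [h2]; apply le_of_eq; ring

/-- Summation by parts. The boundary factor carries `lam N`, although `partialSum` at `N` stops at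
index `N - 1`. -/
theorem partialSum_eq_abel (lam : ℕ → ℝ) (a : ℕ → ℂ) (s₀ s : ℂ) (N : ℕ) :
    partialSum lam a s N = partialSum lam a s₀ N * Complex.exp (-(lam N : ℂ) * (s - s₀))
      + ∑ n ∈ Finset.range N, partialSum lam a s₀ (n + 1) *
        (Complex.exp (-(lam n : ℂ) * (s - s₀)) - Complex.exp (-(lam (n + 1) : ℂ) * (s - s₀))) := by
  induction N with
  | zero => simp [partialSum]
  | succ N ih =>
    have h1 : ∀ w, partialSum lam a w (N + 1)
        = partialSum lam a w N + a N * Complex.exp (-(lam N : ℂ) * w) := fun w =>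
      Finset.sum_range_succ _ _
    have h2 : Complex.exp (-(lam N : ℂ) * s)
        = Complex.exp (-(lam N : ℂ) * s₀) * Complex.exp (-(lam N : ℂ) * (s - s₀)) := by
      rw [← Complex.exp_add]; congr 1; ring
    rw [h1 s, ih, Finset.sum_range_succ, h1 s₀, h2]
    ring

variable {lam : ℕ → ℝ} {a : ℕ → ℂ} {s₀ s : ℂ} {M : ℝ}

theorem sum_norm_abel_le (hlam : IsFrequency lam) (hM : ∀ N, ‖partialSum lam a s₀ N‖ ≤ M)
    (hs : 0 < (s - s₀).re) (N : ℕ) :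
    ∑ n ∈ Finset.range N, ‖partialSum lam a s₀ (n + 1) *
      (Complex.exp (-(lam n : ℂ) * (s - s₀)) - Complex.exp (-(lam (n + 1) : ℂ) * (s - s₀)))‖
      ≤ M * (‖s - s₀‖ / (s - s₀).re) := by
  have hM0 : 0 ≤ M := (norm_nonneg _).trans (hM 0)
  have h0 : 0 ≤ M * (‖s - s₀‖ / (s - s₀).re) := by positivity
  calc _ ≤ ∑ n ∈ Finset.range N, M * (‖s - s₀‖ / (s - s₀).re) *
        (Real.exp (-lam n * (s - s₀).re) - Real.exp (-lam (n + 1) * (s - s₀).re)) := by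
        refine Finset.sum_le_sum fun n _ => ?_
        rw [norm_mul, mul_assoc]
        exact mul_le_mul (hM _) (norm_exp_sub_exp_le hs (hlam.strictMono n.lt_succ_self).le)
          (norm_nonneg _) hM0
    _ = M * (‖s - s₀‖ / (s - s₀).re) *
        (Real.exp (-lam 0 * (s - s₀).re) - Real.exp (-lam N * (s - s₀).re)) := by
        rw [← Finset.mul_sum, Finset.sum_range_sub' (fun n => Real.exp (-lam n * (s - s₀).re))]
    _ ≤ _ := by
        refine mul_le_of_le_one_right h0 ?_
        have h1 : Real.exp (-lam 0 * (s - s₀).re) ≤ 1 := by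
          rw [Real.exp_le_one_iff]
          have := mul_nonneg (hlam.nonneg 0) hs.le
          linarith
        linarith [Real.exp_pos (-lam N * (s - s₀).re)]

theorem norm_exp_neg_mul (x : ℝ) (z : ℂ) :
    ‖Complex.exp (-(x : ℂ) * z)‖ = Real.exp (-x * z.re) := by
  rw [Complex.norm_exp]; simp

/-- On a vertical line `(s - s₀).re` is fixed, so this bound, uniform in `N`, grows only linearly in
`|im s|`. -/
theorem norm_partialSum_le (hlam : IsFrequency lam) (hM : ∀ N, ‖partialSum lam a s₀ N‖ ≤ M)
    (hs : 0 < (s - s₀).re) (N : ℕ) :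
    ‖partialSum lam a s N‖ ≤ M * (1 + ‖s - s₀‖ / (s - s₀).re) := by
  have hM0 : 0 ≤ M := (norm_nonneg _).trans (hM 0)
  rw [partialSum_eq_abel lam a s₀ s N, mul_add, mul_one]
  refine (norm_add_le _ _).trans (add_le_add ?_ ?_)
  · rw [norm_mul, norm_exp_neg_mul]
    refine (mul_le_of_le_one_right (norm_nonneg _) ?_).trans (hM N)
    rw [Real.exp_le_one_iff]
    have := mul_nonneg (hlam.nonneg N) hs.le
    linarith
  · exact (norm_sum_le _ _).trans (sum_norm_abel_le hlam hM hs N)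

theorem convergesAt_of_bounded (hlam : IsFrequency lam) (hM : ∀ N, ‖partialSum lam a s₀ N‖ ≤ M)
    (hs : 0 < (s - s₀).re) : ConvergesAt lam a s := by
  have hsum := (summable_of_sum_range_le (fun _ => norm_nonneg _)
    (sum_norm_abel_le hlam hM hs)).of_norm
  have h1 : Tendsto (fun N => partialSum lam a s₀ N * Complex.exp (-(lam N : ℂ) * (s - s₀)))
      atTop (𝓝 0) := by
    have hexp : Tendsto (fun N => M * Real.exp (-lam N * (s - s₀).re)) atTop (𝓝 0) := by
      rw [← mul_zero M]
      refine Tendsto.const_mul M (Real.tendsto_exp_atBot.comp ?_)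
      exact (tendsto_neg_atTop_atBot.comp hlam.tendsto_atTop).atBot_mul_const hs
    refine squeeze_zero_norm (fun N => ?_) hexp
    rw [norm_mul, norm_exp_neg_mul]
    gcongr
    exact hM N
  refine ⟨_, ((h1.add hsum.hasSum.tendsto_sum_nat).congr fun N => ?_)⟩
  exact (partialSum_eq_abel lam a s₀ s N).symm

theorem ConvergesAt.exists_bound (h : ConvergesAt lam a s₀) :
    ∃ M, ∀ N, ‖partialSum lam a s₀ N‖ ≤ M := by
  obtain ⟨l, hl⟩ := h
  obtain ⟨M, hM⟩ := (Metric.isBounded_range_of_tendsto _ hl).exists_norm_le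
  exact ⟨M, fun N => hM _ ⟨N, rfl⟩⟩

end Abel

/-! ### Damping `ψ` while controlling the support of its transform -/

section Window

/-- The function `t ↦ ∫₀¹ exp(i t u) du`. -/
noncomputable def window (t : ℝ) : ℂ := ∫ u in (0 : ℝ)..1, Complex.exp (Complex.I * t * u)

theorem continuous_window : Continuous window := by
  unfold window
  exact intervalIntegral.continuous_parametric_intervalIntegral_of_continuous'
    (by simp only [Function.uncurry_def]; fun_prop) _ _

theorem window_zero : window 0 = 1 := by simp [window]

theorem norm_window_le_one (t : ℝ) : ‖window t‖ ≤ 1 := by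
  have h := intervalIntegral.norm_integral_le_of_norm_le_const (a := (0 : ℝ)) (b := 1) (C := 1)
    (f := fun u : ℝ => Complex.exp (Complex.I * t * u)) (fun u _ => by
      rw [Complex.norm_exp]; simp)
  simpa [window] using h

/-- This `1/|t|` decay gives the damped function an integrable first moment. -/
theorem norm_mul_window_le_two (t : ℝ) : ‖(t : ℂ) * window t‖ ≤ 2 := by
  by_cases ht : t = 0
  · simp [ht]
  have hc : Complex.I * (t : ℂ) ≠ 0 := mul_ne_zero Complex.I_ne_zero (by exact_mod_cast ht)
  have h : (t : ℂ) * window t = (Complex.exp (Complex.I * t) - 1) / Complex.I := by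
    rw [window, integral_exp_mul_complex hc]
    simp only [Complex.ofReal_one, mul_one, Complex.ofReal_zero, mul_zero, Complex.exp_zero]
    have : (t : ℂ) ≠ 0 := by exact_mod_cast ht
    field_simp
  rw [h, norm_div, Complex.norm_I, div_one]
  refine (norm_sub_le _ _).trans ?_
  rw [Complex.norm_exp]
  simp
  norm_num

variable {ψ : ℝ → ℂ}

theorem integrable_mul_window (hψ : Integrable ψ volume) (ε : ℝ) :
    Integrable (fun t => ψ t * window (ε * t)) volume :=
  hψ.mul_bdd (c := 1)
    (continuous_window.comp (continuous_const.mul continuous_id)).aestronglyMeasurable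
    (ae_of_all _ fun _ => norm_window_le_one _)

theorem integrable_id_mul_mul_window (hψ : Integrable ψ volume) {ε : ℝ} (hε : ε ≠ 0) :
    Integrable (fun t : ℝ => (t : ℂ) * (ψ t * window (ε * t))) volume := by
  have h : Integrable (fun t : ℝ => ψ t * ((t : ℂ) * window (ε * t))) volume := by
    refine hψ.mul_bdd (c := 2 / |ε|) (Continuous.aestronglyMeasurable
      (Complex.continuous_ofReal.mul (continuous_window.comp
        (continuous_const.mul continuous_id)))) (ae_of_all _ fun t => ?_)
    rw [le_div_iff₀ (abs_pos.2 hε)]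
    have := norm_mul_window_le_two (ε * t)
    rw [norm_mul, Complex.norm_real, Real.norm_eq_abs, abs_mul] at this
    rw [norm_mul, Complex.norm_real, Real.norm_eq_abs]
    linarith
  refine h.congr (ae_of_all _ fun t => ?_)
  ring

/-- `window (ε t)` is an average of the exponentials `exp(i t ε u)`, each of which shifts the
transform by `ε u`. -/
theorem fourierLine_mul_window (hψ : Integrable ψ volume) (ε x : ℝ) :
    fourierLine (fun t => ψ t * window (ε * t)) x
      = ∫ u in (0 : ℝ)..1, fourierLine ψ (x - ε * u) := by
  have hint : Integrable (fun p : ℝ × ℝ => ψ p.1 *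
      Complex.exp (-Complex.I * (p.1 : ℂ) * ((x - ε * p.2 : ℝ) : ℂ)))
      (volume.prod (volume.restrict (Set.Ioc (0 : ℝ) 1))) := by
    have h1 : Integrable (fun p : ℝ × ℝ => ψ p.1 * (1 : ℂ))
        (volume.prod (volume.restrict (Set.Ioc (0 : ℝ) 1))) :=
      hψ.mul_prod (integrable_const 1)
    simp only [mul_one] at h1
    refine h1.mul_bdd (c := 1) (Continuous.aestronglyMeasurable (by fun_prop))
      (ae_of_all _ fun p => ?_)
    rw [Complex.norm_exp]
    simp
  rw [intervalIntegral.integral_of_le zero_le_one]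
  unfold fourierLine
  rw [← integral_integral_swap (f := fun t u : ℝ => ψ t *
      Complex.exp (-Complex.I * (t : ℂ) * ((x - ε * u : ℝ) : ℂ))) hint]
  congr 1
  ext t
  change ψ t * window (ε * t) * _ = _
  rw [integral_const_mul, window, intervalIntegral.integral_of_le zero_le_one, mul_assoc,
    ← integral_mul_const]
  congr 2
  ext u
  rw [← Complex.exp_add]
  congr 1
  push_cast
  ring

theorem fourierLine_mul_window_eq_zero (hψ : Integrable ψ volume) {R : ℝ}
    (hR : ∀ x, R < x → fourierLine ψ x = 0) {ε : ℝ} (hε : ε ≤ 1) {x : ℝ}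
    (hx : R + 1 < x) : fourierLine (fun t => ψ t * window (ε * t)) x = 0 := by
  rw [fourierLine_mul_window hψ]
  refine (intervalIntegral.integral_congr (g := fun _ => 0) fun u hu => ?_).trans (by simp)
  rw [Set.uIcc_of_le zero_le_one] at hu
  refine hR _ ?_
  have := mul_le_one₀ hε hu.1 hu.2
  linarith

theorem tendsto_integral_mul_window (hψ : Integrable ψ volume) {h : ℝ → ℂ} (hh : Continuous h)
    {C : ℝ} (hC : ∀ t, ‖h t‖ ≤ C) {ε : ℕ → ℝ} (hε : Tendsto ε atTop (𝓝 0)) :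
    Tendsto (fun k => ∫ t, h t * (ψ t * window (ε k * t))) atTop (𝓝 (∫ t, h t * ψ t)) := by
  refine tendsto_integral_of_dominated_convergence (fun t => C * ‖ψ t‖)
    (fun k => hh.aestronglyMeasurable.mul (integrable_mul_window hψ _).aestronglyMeasurable)
    (hψ.norm.const_mul C) (fun k => ae_of_all _ fun t => ?_) (ae_of_all _ fun t => ?_)
  · rw [norm_mul, norm_mul]
    exact mul_le_mul (hC t) (mul_le_of_le_one_right (norm_nonneg _) (norm_window_le_one _))
      (by positivity) ((norm_nonneg _).trans (hC t))
  · have h1 : Tendsto (fun k => window (ε k * t)) atTop (𝓝 (window (0 * t))) :=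
      (continuous_window.tendsto _).comp (hε.mul_const t)
    rw [zero_mul, window_zero] at h1
    simpa using (h1.const_mul (ψ t)).const_mul (h t)

end Window

/-! ### The identity for bounded holomorphic extensions -/

section BoundedExtension

variable {lam : ℕ → ℝ} {a : ℕ → ℂ} {f : ℂ → ℂ} {ψ : ℝ → ℂ}

theorem IsBoundedExtension.continuous_line (hf : IsBoundedExtension lam a f) {s : ℂ}
    (hs : 0 < s.re) : Continuous fun t : ℝ => f (s + Complex.I * (t : ℂ)) := by
  refine hf.differentiableOn.continuousOn.comp_continuous (by fun_prop) fun t => ?_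
  simpa using hs

theorem IsBoundedExtension.integrable_line (hf : IsBoundedExtension lam a f)
    (hψ : Integrable ψ volume) {s : ℂ} (hs : 0 < s.re) :
    Integrable (fun t : ℝ => f (s + Complex.I * (t : ℂ)) * ψ t) volume := by
  obtain ⟨C, hC⟩ := hf.bounded
  exact hψ.bdd_mul (c := C) (hf.continuous_line hs).aestronglyMeasurable
    (ae_of_all _ fun t => hC _ (by simpa using hs))

theorem integral_partialSum_mul (hψ : Integrable ψ volume) (s : ℂ) (N : ℕ) :
    ∫ t : ℝ, partialSum lam a (s + Complex.I * (t : ℂ)) N * ψ t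
      = ∑ n ∈ Finset.range N, a n * fourierLine ψ (lam n) * Complex.exp (-(lam n : ℂ) * s) := by
  unfold partialSum fourierLine
  simp_rw [Finset.sum_mul]
  have he : ∀ (n : ℕ) (t : ℝ), a n * Complex.exp (-(lam n : ℂ) * (s + Complex.I * (t : ℂ))) * ψ t
      = a n * Complex.exp (-(lam n : ℂ) * s)
        * (ψ t * Complex.exp (-Complex.I * (t : ℂ) * (lam n : ℂ))) := fun n t => by
    rw [mul_add, Complex.exp_add, show -(lam n : ℂ) * (Complex.I * (t : ℂ))
      = -Complex.I * (t : ℂ) * (lam n : ℂ) by ring]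
    ring
  simp_rw [he]
  rw [integral_finsetSum]
  · refine Finset.sum_congr rfl fun n _ => ?_
    rw [integral_const_mul]
    ring
  · intro n _
    refine Integrable.const_mul ?_ _
    refine hψ.mul_bdd (c := 1) (Continuous.aestronglyMeasurable (by fun_prop))
      (ae_of_all _ fun t => ?_)
    rw [Complex.norm_exp]
    simp

/-- Dominated convergence: the partial sums are at most linear in `|t|`, and the first-moment
hypothesis makes the majorant integrable. -/
theorem IsBoundedExtension.tendsto_sum_of_integrable_id_mul (hf : IsBoundedExtension lam a f)
    (hlam : IsFrequency lam) (hψ : Integrable ψ volume)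
    (hψ' : Integrable (fun t : ℝ => (t : ℂ) * ψ t) volume) {s₀ s : ℂ}
    (hs₀ : ConvergesAt lam a s₀) (hs : 0 < s.re) (hss : s₀.re < s.re) :
    Tendsto (fun N => ∑ n ∈ Finset.range N,
        a n * fourierLine ψ (lam n) * Complex.exp (-(lam n : ℂ) * s)) atTop
      (𝓝 (∫ t : ℝ, f (s + Complex.I * (t : ℂ)) * ψ t)) := by
  obtain ⟨M, hM⟩ := hs₀.exists_bound
  have hM0 : 0 ≤ M := (norm_nonneg _).trans (hM 0)
  simp_rw [← integral_partialSum_mul hψ]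
  set δ := s.re - s₀.re with hδ
  have hδ0 : 0 < δ := sub_pos.2 hss
  have hre : ∀ t : ℝ, (s + Complex.I * (t : ℂ) - s₀).re = δ := fun t => by simp [hδ]
  refine tendsto_integral_of_dominated_convergence
    (fun t => M * (1 + ‖s - s₀‖ / δ) * ‖ψ t‖ + M / δ * ‖(t : ℂ) * ψ t‖)
    (fun N => ?_) ((hψ.norm.const_mul _).add (hψ'.norm.const_mul _))
    (fun N => ae_of_all _ fun t => ?_) (ae_of_all _ fun t => ?_)
  · refine AEStronglyMeasurable.mul (Continuous.aestronglyMeasurable ?_) hψ.aestronglyMeasurable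
    unfold partialSum
    fun_prop
  · have h1 := norm_partialSum_le (s := s + Complex.I * (t : ℂ)) hlam hM (by rwa [hre]) N
    rw [hre] at h1
    have h2 : ‖s + Complex.I * (t : ℂ) - s₀‖ ≤ ‖s - s₀‖ + |t| := by
      rw [add_sub_right_comm]
      refine (norm_add_le _ _).trans ?_
      simp
    rw [norm_mul]
    calc _ ≤ M * (1 + (‖s - s₀‖ + |t|) / δ) * ‖ψ t‖ := by
          gcongr
          exact h1.trans (by gcongr)
      _ = _ := by
          rw [norm_mul, Complex.norm_real, Real.norm_eq_abs]
          ring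
  · obtain ⟨l, hl⟩ := convergesAt_of_bounded (s := s + Complex.I * (t : ℂ)) hlam hM
      (by rwa [hre])
    rw [hf.extends_sum (s + Complex.I * (t : ℂ)) (by simpa using hs)
      ⟨s₀, by simpa using hss, hs₀⟩ l hl]
    exact hl.mul_const _

theorem IsBoundedExtension.integral_eq_sum_of_re_gt (hf : IsBoundedExtension lam a f)
    (hlam : IsFrequency lam) (hψ : Integrable ψ volume) {R : ℝ}
    (hR : ∀ x, R < x → fourierLine ψ x = 0) {N : ℕ} (hN : ∀ n, N ≤ n → R + 1 < lam n) {s₀ s : ℂ}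
    (hs₀ : ConvergesAt lam a s₀) (hs : 0 < s.re) (hss : s₀.re < s.re) :
    ∫ t : ℝ, f (s + Complex.I * (t : ℂ)) * ψ t
      = ∑ n ∈ Finset.range N, a n * fourierLine ψ (lam n) * Complex.exp (-(lam n : ℂ) * s) := by
  obtain ⟨C, hC⟩ := hf.bounded
  let ε : ℕ → ℝ := fun k => 1 / ((k : ℝ) + 1)
  have hε : Tendsto ε atTop (𝓝 0) := tendsto_one_div_add_atTop_nhds_zero_nat
  have hε0 : ∀ k, 0 < ε k := fun k => by positivity
  have hε1 : ∀ k, ε k ≤ 1 := fun k => by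
    simp only [ε]
    rw [div_le_one (by positivity)]
    linarith [(Nat.cast_nonneg k : (0 : ℝ) ≤ k)]
  have heq : ∀ k, ∫ t : ℝ, f (s + Complex.I * (t : ℂ)) * (ψ t * window (ε k * t))
      -- All damped transforms vanish beyond `R + 1`, so one `N` serves every `k` and the limit `k →
      -- ∞` passes through a sum of fixed length.
      = ∑ n ∈ Finset.range N, a n * fourierLine (fun t => ψ t * window (ε k * t)) (lam n)
        * Complex.exp (-(lam n : ℂ) * s) := fun k => by
    refine tendsto_nhds_unique (hf.tendsto_sum_of_integrable_id_mul hlam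
      (integrable_mul_window hψ (ε k)) (integrable_id_mul_mul_window hψ (hε0 k).ne') hs₀ hs hss) ?_
    refine tendsto_const_nhds.congr' ?_
    filter_upwards [eventually_ge_atTop N] with K hK
    refine Finset.sum_subset (Finset.range_subset_range.2 hK) fun n _ hn => ?_
    rw [fourierLine_mul_window_eq_zero hψ hR (hε1 k)
      (hN n (not_lt.1 fun h => hn (Finset.mem_range.2 h))), mul_zero, zero_mul]
  have hlim := tendsto_integral_mul_window hψ (hf.continuous_line hs)
    (fun t => hC _ (by simpa using hs)) hε
  refine tendsto_nhds_unique hlim ?_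
  simp_rw [heq]
  refine tendsto_finsetSum _ fun n _ => ?_
  refine ((Tendsto.const_mul (a n) ?_).mul_const _)
  have := tendsto_integral_mul_window hψ (h := fun t : ℝ =>
    Complex.exp (-Complex.I * (t : ℂ) * (lam n : ℂ))) (by fun_prop) (C := 1)
    (fun t => by rw [Complex.norm_exp]; simp) hε
  unfold fourierLine
  simpa only [mul_comm (Complex.exp _)] using this

theorem IsBoundedExtension.differentiableOn_integral (hf : IsBoundedExtension lam a f)
    (hψ : Integrable ψ volume) :
    DifferentiableOn ℂ (fun s => ∫ t : ℝ, f (s + Complex.I * (t : ℂ)) * ψ t) {s | 0 < s.re} := by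
  obtain ⟨C, hC⟩ := hf.bounded
  have hopen : IsOpen {s : ℂ | 0 < s.re} := isOpen_lt continuous_const Complex.continuous_re
  intro s hs
  have hs' : 0 < s.re := hs
  -- With this `r`, closed `r`-discs centred at points of `ball s r`, or at their vertical
  -- translates, stay in `0 < re`, so Cauchy's estimate bounds `deriv f` by `C / r`.
  set r := s.re / 4 with hr
  have hr0 : 0 < r := by positivity
  have hball : ∀ {w z : ℂ}, dist z w ≤ r → w.re - r ≤ z.re := fun {w z} h => by
    have := (Complex.abs_re_le_norm (z - w)).trans (by rwa [← dist_eq_norm] : ‖z - w‖ ≤ r)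
    rw [Complex.sub_re] at this
    linarith [(abs_le.1 this).1]
  have hpos : ∀ z ∈ Metric.ball s r, ∀ t : ℝ, 2 * r < (z + Complex.I * (t : ℂ)).re := by
    intro z hz t
    have := hball (Metric.mem_ball.1 hz).le
    simp
    linarith
  refine (hasDerivAt_integral_of_dominated_loc_of_deriv_le (𝕜 := ℂ)
    (F := fun z (t : ℝ) => f (z + Complex.I * (t : ℂ)) * ψ t)
    (F' := fun z (t : ℝ) => deriv f (z + Complex.I * (t : ℂ)) * ψ t)
    (bound := fun t => C / r * ‖ψ t‖) (Metric.ball_mem_nhds s hr0) ?_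
    (hf.integrable_line hψ hs') ?_ ?_ (hψ.norm.const_mul _) ?_).2.differentiableAt.differentiableWithinAt
  · filter_upwards [hopen.mem_nhds hs] with z hz
    exact (hf.integrable_line hψ hz).aestronglyMeasurable
  · refine AEStronglyMeasurable.mul (Continuous.aestronglyMeasurable ?_) hψ.aestronglyMeasurable
    refine (hf.differentiableOn.deriv hopen).continuousOn.comp_continuous (by fun_prop) fun t => ?_
    simpa using hs'
  · refine ae_of_all _ fun t z hz => ?_
    rw [norm_mul]
    gcongr
    have h2 := hpos z hz t
    have hsub : ∀ w, dist w (z + Complex.I * (t : ℂ)) ≤ r → 0 < w.re := fun w hw => by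
      have := hball hw
      linarith
    refine Complex.norm_deriv_le_of_forall_mem_sphere_norm_le hr0 ?_
      fun w hw => hC _ (hsub w (Metric.mem_sphere.1 hw).le)
    refine DifferentiableOn.diffContOnCl (hf.differentiableOn.mono fun w hw => ?_)
    exact hsub w (Metric.mem_closedBall.1 (Metric.closure_ball_subset_closedBall hw))
  · refine ae_of_all _ fun t z hz => ?_
    have h2 : 0 < (z + Complex.I * (t : ℂ)).re := (by positivity : 0 < 2 * r).trans (hpos z hz t)
    have h3 := (hf.differentiableOn.differentiableAt (hopen.mem_nhds h2)).hasDerivAt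
    exact (h3.comp_add_const z _).mul_const _

theorem IsBoundedExtension.hasSum_integral (hf : IsBoundedExtension lam a f)
    (hlam : IsFrequency lam) (hψ : Integrable ψ volume)
    (hψ_supp : HasCompactSupport (fourierLine ψ)) {s : ℂ} (hs : 0 < s.re) :
    HasSum (fun n : ℕ => a n * fourierLine ψ (lam n) * Complex.exp (-(lam n : ℂ) * s))
      (∫ t : ℝ, f (s + Complex.I * (t : ℂ)) * ψ t) := by
  obtain ⟨R, hR⟩ := hψ_supp.isCompact.isBounded.bddAbove
  have hR' : ∀ x, R < x → fourierLine ψ x = 0 := fun x hx => by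
    by_contra h
    exact absurd (hR (subset_tsupport _ h)) (not_le.2 hx)
  obtain ⟨N, hN⟩ := (hlam.tendsto_atTop.eventually_gt_atTop (R + 1)).exists_forall_of_atTop
  obtain ⟨s₀, hs₀⟩ := hf.somewhere_convergent
  have hopen : IsOpen {s : ℂ | 0 < s.re} := isOpen_lt continuous_const Complex.continuous_re
  -- `σ` lies in both half-planes `0 < re` and `s₀.re < re`; near it the identity is known, and it
  -- spreads by analyticity.
  set σ : ℝ := max 0 s₀.re + 1 with hσ
  have hσ0 : 0 < σ := by positivity
  have hσ1 : s₀.re < σ := (le_max_right 0 s₀.re).trans_lt (lt_add_one _)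
  have heq : Set.EqOn (fun s => ∫ t : ℝ, f (s + Complex.I * (t : ℂ)) * ψ t)
      (fun s => ∑ n ∈ Finset.range N, a n * fourierLine ψ (lam n) * Complex.exp (-(lam n : ℂ) * s))
      {s | 0 < s.re} := by
    refine AnalyticOnNhd.eqOn_of_preconnected_of_eventuallyEq (z₀ := (σ : ℂ))
      ((hf.differentiableOn_integral hψ).analyticOnNhd hopen)
      (DifferentiableOn.analyticOnNhd (by fun_prop) hopen)
      (convex_halfSpace_re_gt 0).isPreconnected (by simpa using hσ0) ?_
    have h1 : {z : ℂ | 0 < z.re ∧ s₀.re < z.re} ∈ 𝓝 (σ : ℂ) := by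
      refine IsOpen.mem_nhds (hopen.inter (isOpen_lt continuous_const Complex.continuous_re)) ?_
      exact ⟨by simpa using hσ0, by simpa using hσ1⟩
    filter_upwards [h1] with z hz
    exact hf.integral_eq_sum_of_re_gt hlam hψ hR' hN hs₀ hz.1 hz.2
  rw [show ∫ t : ℝ, f (s + Complex.I * (t : ℂ)) * ψ t = _ from heq hs]
  refine hasSum_sum_of_ne_finset_zero fun n hn => ?_
  have := hN n (not_lt.1 fun h => hn (Finset.mem_range.2 h))
  rw [hR' _ (by linarith), mul_zero, zero_mul]

end BoundedExtension

end GeneralDirichlet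

theorem mainTheorem6 (ψ : ℝ → ℂ) (hψ : Integrable ψ volume)
    (hψ_supp : HasCompactSupport (GeneralDirichlet.fourierLine ψ))
    (lam : ℕ → ℝ) (hlam : GeneralDirichlet.IsFrequency lam) :
    (∀ (a : ℕ → ℂ) (f : ℂ → ℂ), GeneralDirichlet.IsBoundedExtension lam a f →
      ∀ s : ℂ, 0 < s.re →
        Integrable (fun t : ℝ => f (s + Complex.I * (t : ℂ)) * ψ t) volume ∧
        HasSum
          (fun n : ℕ => a n * GeneralDirichlet.fourierLine ψ (lam n)
            * Complex.exp (-(lam n : ℂ) * s))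
          (∫ t : ℝ, f (s + Complex.I * (t : ℂ)) * ψ t)) ∧
    (∀ (G : Type*) [CommGroup G] [TopologicalSpace G] [IsTopologicalGroup G]
      [CompactSpace G] [T2Space G] [MeasurableSpace G] [BorelSpace G]
      (μ : Measure G) [μ.IsHaarMeasure] [μ.Regular] [IsProbabilityMeasure μ]
      (β : Multiplicative ℝ →ₜ* G) (hβ : GeneralDirichlet.IsDirichletGroup lam β)
      (f : G → ℂ), GeneralDirichlet.MemHardy hβ 1 μ f →
      ∀ᵐ ω ∂μ,
        Integrable (fun t : ℝ => f (ω * β (Multiplicative.ofAdd t)) * ψ t) volume ∧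
        HasSum
          (fun n : ℕ => GeneralDirichlet.fourierCoeff μ f (hβ.char n)
            * GeneralDirichlet.fourierLine ψ (lam n) * ((hβ.char n ω : Circle) : ℂ))
          (∫ t : ℝ, f (ω * β (Multiplicative.ofAdd t)) * ψ t)) := by
  refine ⟨fun a f hf s hs => ⟨hf.integrable_line hψ hs, hf.hasSum_integral hlam hψ hψ_supp hs⟩, ?_⟩
  intro G _ _ _ _ _ _ _ μ _ _ _ β hβ f hf
  exact GeneralDirichlet.hasSum_flow_of_memHardy hψ hψ_supp hlam hβ hf
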